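/- Let $(W,S)$ be a Coxeter system (of arbitrary rank) with identity $e$, length function $\ell$ and set of reflections $T=\bigcup_{w\in W} wSw^{-1}$. For $w\in W$ let $N(w)=\{t\in T:\ell(tw)<\ell(w)\}$ be its inversion set. A subgroup $W'\le W$ is a reflection subgroup if it is generated by $W'\cap T$; put $\chi(W')=\{t\in T: N(t)\cap W'=\{t\}\}$, and call $W'$ dihedral if $|\chi(W')|=2$. A reflection order is a total order $\preceq$ on $T$, with strict part $\prec$, such that for every dihedral reflection subgroup $W'$, with $\chi(W')=\{r,s\}$, either $r\prec rsr\prec rsrsr\prec\cdots\prec srsrs\prec srs\prec s$ or $s\prec srs\prec srsrs\prec\cdots\prec rsrsr\prec rsr\prec r$. Here, if $rs$ has finite order $m$, the first chain consists of the $m$ reflections $(rs)^ir$, $0\le i<m$, in increasing order of $i$; if $rs$ has infinite order, it means $(rs)^ir\prec(rs)^jr$ and $(sr)^js\prec(sr)^is$ for all $0\le i<j$, and $(rs)^ir\prec(sr)^js$ for all $i,j\ge 0$. The second chain is the first with $r$ and $s$ exchanged. A subset $A\subseteq T$ (possibly infinite) is an initial section if there is a reflection order on $T$ such that $a\prec b$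 for all $a\in A$ and $b\in T\setminus A$. For $A\subseteq T$, the Bruhat preclosure $\overline{A}$ is the set of all $t\in T$ for which there are $n\ge 0$ and $a_1,\dots,a_n\in A$ such that $t=a_1a_2\cdots a_n$ and $\ell(a_1\cdots a_{i-1})<\ell(a_1\cdots a_i)$ for all $1\le i\le n$. Theorem. For every initial section $A\subseteq T$ and every $t\in T$, we have $t\in\overline{A}$ if and only if $t\in A$. Moreover, for every $w\in W$ and every $t\in T$, we have $t\in\overline{N(w)}$ if and only if $t\in N(w)$. -/

import Mathlib

namespace CoxeterSystem

variable {B : Type*} {W : Type*} [Group W] {M : CoxeterMatrix B} (cs : CoxeterSystem M W)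

/-- The set `T` of all reflections, i.e. of all conjugates of simple reflections. -/
def reflections : Set W := {t | cs.IsReflection t}

/-- The inversion set `N(w) = {t ∈ T | ℓ(tw) < ℓ(w)}`. -/
def inversionSet (w : W) : Set W :=
  {t | cs.IsReflection t ∧ cs.length (t * w) < cs.length w}

/-- A reflection subgroup: a subgroup `W'` generated by `W' ∩ T`. -/
def IsReflectionSubgroup (W' : Subgroup W) : Prop :=
  Subgroup.closure ((W' : Set W) ∩ cs.reflections) = W'

/-- The canonical generators `χ(W') = {t ∈ T | N(t) ∩ W' = {t}}` of a reflection subgroup. -/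
def canonicalGenerators (W' : Subgroup W) : Set W :=
  {t | cs.IsReflection t ∧ cs.inversionSet t ∩ (W' : Set W) = {t}}

variable {cs} in
/-- For reflections `r` and `s`, the reflection `(rs)ⁱr = rsr⋯sr`, an alternating word of
length `2i + 1` starting and ending with `r`. -/
def alternating (r s : cs.reflections) (i : ℕ) : cs.reflections :=
  ⟨((r : W) * s) ^ i * r, by
    have key : ∀ (i : ℕ) (a b : W), cs.IsReflection a → cs.IsReflection b →
        cs.IsReflection ((a * b) ^ i * a) := by
      intro i
      induction i with
      | zero => intro a b ha _; simpa using ha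
      | succ i ih =>
        intro a b ha hb
        have h := (ih b a hb ha).conj a
        rw [ha.inv] at h
        have e : (a * b) ^ (i + 1) * a = a * ((b * a) ^ i * b) * a := by
          have hc : ∀ n : ℕ, a * (b * a) ^ n = (a * b) ^ n * a := by
            intro n
            induction n with
            | zero => simp
            | succ n ihn => rw [pow_succ, ← mul_assoc, ihn, pow_succ]; simp only [mul_assoc]
          rw [← mul_assoc, hc, pow_succ]
          simp only [mul_assoc]
        rw [e]
        exact h
    exact key i r s r.2 s.2⟩

variable {cs} in
/-- The chain `r ≺ rsr ≺ rsrsr ≺ ⋯ ≺ srsrs ≺ srs ≺ s`.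

If `rs` has finite order `m`, this chain consists of the `m` reflections `(rs)ⁱr` for
`0 ≤ i < m`, the last ones being `…, (rs)ᵐ⁻²r = srs, (rs)ᵐ⁻¹r = s`.
If `rs` has infinite order (`orderOf (rs) = 0`), it consists of an increasing sequence
`r ≺ rsr ≺ ⋯` followed by a decreasing sequence `⋯ ≺ srs ≺ s`, with all terms of the former
below all terms of the latter. -/
structure IsDihedralChain (lt : cs.reflections → cs.reflections → Prop)
    (r s : cs.reflections) : Prop where
  finite_order : orderOf ((r : W) * s) ≠ 0 →
    ∀ i j : ℕ, i < j → j < orderOf ((r : W) * s) → lt (alternating r s i) (alternating r s j)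
  infinite_order : orderOf ((r : W) * s) = 0 →
    (∀ i j : ℕ, i < j → lt (alternating r s i) (alternating r s j)) ∧
    (∀ i j : ℕ, i < j → lt (alternating s r j) (alternating s r i)) ∧
    (∀ i j : ℕ, lt (alternating r s i) (alternating s r j))

/-- A reflection order: a (strict) total order on `T` such that for every dihedral reflection
subgroup `W'`, with `χ(W') = {r, s}`, `r ≠ s`, either `r ≺ rsr ≺ ⋯ ≺ srs ≺ s` or
`s ≺ srs ≺ ⋯ ≺ rsr ≺ r`. -/
structure IsReflectionOrder (lt : cs.reflections → cs.reflections → Prop) : Prop where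
  strictTotalOrder : IsStrictTotalOrder cs.reflections lt
  dihedral : ∀ W' : Subgroup W, cs.IsReflectionSubgroup W' →
    ∀ r s : cs.reflections, r ≠ s → cs.canonicalGenerators W' = {(r : W), (s : W)} →
      IsDihedralChain lt r s ∨ IsDihedralChain lt s r

/-- An initial section: a subset `A` of `T` such that, for some reflection order on `T`, every
element of `A` precedes every element of `T \ A`. -/
def IsInitialSection (A : Set W) : Prop :=
  A ⊆ cs.reflections ∧
    ∃ lt : cs.reflections → cs.reflections → Prop, cs.IsReflectionOrder lt ∧
      ∀ a b : cs.reflections, (a : W) ∈ A → (b : W) ∉ A → lt a b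

/-- The labelled edges `u —t→ v` of the Bruhat graph: `t ∈ T`, `v = ut` and `ℓ(u) < ℓ(v)`. -/
def BruhatEdge (u t v : W) : Prop :=
  cs.IsReflection t ∧ v = u * t ∧ cs.length u < cs.length v

/-- There is a (right) `A`-path from `u` to `v`: a directed path in the Bruhat graph all of whose
edges are labelled by elements of `A`. -/
def ExistsPath (A : Set W) (u v : W) : Prop :=
  Relation.ReflTransGen (fun x y => ∃ t ∈ A, cs.BruhatEdge x t y) u v

/-- The (right) Bruhat preclosure of `A`: the reflections reachable from `e` by an `A`-path. -/
def bruhatPreclosure (A : Set W) : Set W :=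
  {t | cs.IsReflection t ∧ cs.ExistsPath A 1 t}

end CoxeterSystem

namespace CoxeterSystem

variable {B : Type*} {W : Type*} [Group W] {M : CoxeterMatrix B} (cs : CoxeterSystem M W)

/-! Everything rests on the cocycle identity N(xy) = N(x) + xN(y)x⁻¹ (symmetric difference), which
comes from an action of W on signed reflections.

For an initial section A put f(w) = |N(w) \ A| - |N(w) ∩ A| (`signedCount`). The crux is
`IsReflectionOrder.signedCount_mul`: if t ∉ N(w), then f(tw) < f(w) when t ∈ A, and f(tw) > f(w)
when t ∉ A. Since f(1) = 0, f decreases strictly along the inverses of the vertices of an A-path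
from 1, so a reflection t = t⁻¹ reached by such a path has f(t) < 0. If t were outside A, the crux
with w = 1 would give f(t) > 0.

In f(tw) - f(w) the reflection t contributes -1 or 1 according as t lies in A or not; the others are
paired as u, tut. Each pair lies with t in the dihedral subgroup ⟨t, u⟩, where the order is a chain,
N(w) is a beginning or an end of that chain, and t lies between u and tut exactly when u ∈ N(t)
(`IsReflectionOrder.position`). These facts give every pair a contribution of the right weak sign.
To apply the definition of a reflection order, ⟨t, u⟩ must have exactly two canonical generators
(`IsReflection.exists_canonicalGenerators_eq_pair`).

For A = N(w) no order is needed: ℓ(xw) decreases along the vertices x of an N(w)-path. The converse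
inclusions use paths with one edge. -/

theorem _root_.Function.End.mul_apply {α : Type*} (f g : Function.End α) (a : α) :
    (f * g) a = f (g a) := rfl

theorem _root_.Function.End.one_apply {α : Type*} (a : α) : (1 : Function.End α) a = a := rfl

/-! ### The sign cocycle and the inversion sets -/

open scoped Classical in
/-- The action of a simple reflection on signed reflections. -/
noncomputable def simpleSignMap (i : B) : Function.End (W × ZMod 2) :=
  fun p => (cs.simple i * p.1 * cs.simple i, p.2 + if p.1 = cs.simple i then 1 else 0)

open scoped Classical in
-- The k-th letter applied changes the sign exactly when it equals the conjugate of `p.1` reached so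
-- far, that is, when `p.1` is (sⱼsᵢ)ᵏsⱼ. Each factor sᵢsⱼ accounts for two values of k.
theorem simpleSignMap_mul_pow_apply (i j : B) (n : ℕ) (p : W × ZMod 2) :
    ((cs.simpleSignMap i * cs.simpleSignMap j) ^ n) p =
      ((cs.simple i * cs.simple j) ^ n * p.1 * ((cs.simple i * cs.simple j) ^ n)⁻¹,
        p.2 + ∑ k ∈ Finset.range (2 * n),
          if p.1 = (cs.simple j * cs.simple i) ^ k * cs.simple j then 1 else 0) := by
  induction n with
  | zero => simp [Function.End.one_apply]
  | succ n ih =>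
    have hinv : (cs.simple i * cs.simple j)⁻¹ = cs.simple j * cs.simple i := by simp
    have hc : ∀ k : ℕ, cs.simple j * (cs.simple i * cs.simple j) ^ k =
        (cs.simple j * cs.simple i) ^ k * cs.simple j := by
      intro k
      induction k with
      | zero => simp
      | succ k ihk => rw [pow_succ, ← mul_assoc, ihk, pow_succ]; simp only [mul_assoc]
    have h1 : (cs.simple i * cs.simple j) ^ n * p.1 * ((cs.simple i * cs.simple j) ^ n)⁻¹ =
        cs.simple j ↔ p.1 = (cs.simple j * cs.simple i) ^ (2 * n) * cs.simple j := by
      rw [mul_inv_eq_iff_eq_mul, ← eq_inv_mul_iff_mul_eq, hc, ← inv_pow, hinv, ← mul_assoc,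
        ← pow_add, two_mul]
    have h2 : cs.simple j * ((cs.simple i * cs.simple j) ^ n * p.1 *
        ((cs.simple i * cs.simple j) ^ n)⁻¹) * cs.simple j = cs.simple i ↔
        p.1 = (cs.simple j * cs.simple i) ^ (2 * n + 1) * cs.simple j := by
      rw [← eq_mul_inv_iff_mul_eq, ← eq_inv_mul_iff_mul_eq, mul_inv_eq_iff_eq_mul,
        ← eq_inv_mul_iff_mul_eq, ← inv_pow, hinv, cs.inv_simple]
      have : (cs.simple j * cs.simple i) ^ n * (cs.simple j * (cs.simple i * cs.simple j) *
          (cs.simple i * cs.simple j) ^ n) =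
          (cs.simple j * cs.simple i) ^ (2 * n + 1) * cs.simple j := by
        rw [mul_assoc (cs.simple j), ← pow_succ', hc, ← mul_assoc, ← pow_add]
        congr 2
        omega
      rw [this]
    rw [pow_succ', Function.End.mul_apply, ih, Function.End.mul_apply,
      show 2 * (n + 1) = 2 * n + 1 + 1 by ring, Finset.sum_range_succ,
      Finset.sum_range_succ, ← h1, ← h2]
    ext
    · simp only [simpleSignMap, pow_succ', mul_inv_rev, cs.inv_simple, mul_assoc]
    · simp only [simpleSignMap, add_assoc]

/-- With m = M i j, the indices k and k + m give the same reflection, so the sign changes cancel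
modulo 2. -/
theorem isLiftable_simpleSignMap : M.IsLiftable cs.simpleSignMap := by
  classical
  intro i j
  funext p
  rw [simpleSignMap_mul_pow_apply, cs.simple_mul_simple_pow, two_mul, Finset.sum_range_add]
  simp only [pow_add, cs.simple_mul_simple_pow' i j, one_mul, ← two_mul]
  ext
  · simp [Function.End.one_apply]
  · simp [Function.End.one_apply, CharTwo.two_eq_zero]

/-- The action of `W` on signed reflections. -/
noncomputable def signAction : W →* Function.End (W × ZMod 2) :=
  cs.lift ⟨cs.simpleSignMap, cs.isLiftable_simpleSignMap⟩

/-- The sign picked up by `t` under the action of `w`. -/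
noncomputable def signCocycle (w t : W) : ZMod 2 := (cs.signAction w (t, 0)).2

theorem signAction_apply (w t : W) (e : ZMod 2) :
    cs.signAction w (t, e) = (w * t * w⁻¹, e + cs.signCocycle w t) := by
  suffices h : ∀ t e, (cs.signAction w (t, e)).1 = w * t * w⁻¹ ∧
      (cs.signAction w (t, e)).2 = e + (cs.signAction w (t, 0)).2 from
    Prod.ext (h t e).1 (h t e).2
  induction w using cs.simple_induction_left with
  | one => simp [Function.End.one_apply]
  | mul_simple_left w i ih =>
    intro t e
    rw [map_mul]
    simp only [Function.End.mul_apply, signAction, lift_apply_simple] at ih ⊢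
    simp only [simpleSignMap, (ih t e).1, (ih t e).2, (ih t 0).1, mul_inv_rev, cs.inv_simple,
      mul_assoc, add_assoc]
    rw [(ih t e).1, (ih t 0).1]
    exact ⟨trivial, rfl⟩

theorem signCocycle_mul (x y t : W) :
    cs.signCocycle (x * y) t = cs.signCocycle y t + cs.signCocycle x (y * t * y⁻¹) := by
  rw [signCocycle, map_mul, Function.End.mul_apply, signAction_apply,
    signAction_apply, zero_add]

open scoped Classical in
theorem signCocycle_simple (i : B) (t : W) :
    cs.signCocycle (cs.simple i) t = if t = cs.simple i then 1 else 0 := by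
  simp [signCocycle, signAction, lift_apply_simple, simpleSignMap]

theorem signCocycle_one (t : W) : cs.signCocycle 1 t = 0 := by
  simp [signCocycle, Function.End.one_apply]

variable {cs} in
-- For t = wsw⁻¹ the contributions of w and w⁻¹ cancel, leaving that of s at s.
theorem IsReflection.signCocycle_self {t : W} (ht : cs.IsReflection t) :
    cs.signCocycle t t = 1 := by
  obtain ⟨w, i, rfl⟩ := ht
  have h := cs.signCocycle_mul w w⁻¹ (w * cs.simple i * w⁻¹)
  have e : w⁻¹ * (w * cs.simple i * w⁻¹) * w⁻¹⁻¹ = cs.simple i := by group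
  rw [mul_inv_cancel, signCocycle_one, e] at h
  rw [signCocycle_mul, signCocycle_mul, e]
  simp only [cs.simple_mul_simple_self, one_mul, cs.inv_simple, signCocycle_simple, if_true]
  rw [add_left_comm, ← h, add_zero]

theorem mem_leftInvSeq_of_signCocycle_ne_zero (ω : List B) (t : W)
    (h : cs.signCocycle (cs.wordProd ω)⁻¹ t ≠ 0) : t ∈ cs.leftInvSeq ω := by
  classical
  induction ω generalizing t with
  | nil => simp [signCocycle_one] at h
  | cons i ω ih =>
    rw [wordProd_cons, mul_inv_rev, cs.inv_simple, signCocycle_mul, signCocycle_simple] at h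
    by_cases hi : t = cs.simple i
    · simp [leftInvSeq, hi]
    · rw [if_neg hi, zero_add] at h
      refine List.mem_cons_of_mem _ (List.mem_map.2 ⟨_, ih _ h, ?_⟩)
      simp [mul_assoc]

variable {cs} in
theorem IsReflection.mem_inversionSet_iff {t : W} (ht : cs.IsReflection t) (w : W) :
    t ∈ cs.inversionSet w ↔ cs.signCocycle w⁻¹ t = 1 := by
  have key : ∀ w, cs.signCocycle w⁻¹ t ≠ 0 → t ∈ cs.inversionSet w := by
    intro w h
    obtain ⟨ω, hω, rfl⟩ := cs.exists_isReduced w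
    exact cs.isLeftInversion_of_mem_leftInvSeq hω
      (cs.mem_leftInvSeq_of_signCocycle_ne_zero ω t h)
  refine ⟨fun h => ?_, fun h => key w (by rw [h]; exact one_ne_zero)⟩
  by_contra h1
  have h0 : cs.signCocycle w⁻¹ t = 0 := by
    revert h1
    generalize cs.signCocycle w⁻¹ t = a
    revert a
    decide
  -- Multiplying w by t changes the cocycle at t by 1, so its vanishing at w would make t an
  -- inversion of tw as well as of w.
  have h2 := key (t * w) (by
    rw [mul_inv_rev, ht.inv, signCocycle_mul, ht.signCocycle_self, ht.inv, ht.mul_self, one_mul,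
      h0, add_zero]
    exact one_ne_zero)
  have h3 := h2.2
  rw [← mul_assoc, ht.mul_self, one_mul] at h3
  exact lt_asymm h.2 h3

variable {cs} in
theorem IsReflection.conj_inv {t : W} (ht : cs.IsReflection t) (w : W) :
    cs.IsReflection (w⁻¹ * t * w) := by
  simpa using ht.conj w⁻¹

variable {cs} in
theorem IsReflection.conj_mul {t r : W} (ht : cs.IsReflection t) (hr : cs.IsReflection r) :
    cs.IsReflection (r * t * r) := by
  simpa [hr.inv] using ht.conj r

variable {cs} in
/-- The cocycle identity `N(xy) = N(x) + x N(y) x⁻¹`. -/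
theorem IsReflection.mem_inversionSet_mul {t : W} (ht : cs.IsReflection t) (x y : W) :
    t ∈ cs.inversionSet (x * y) ↔
      ¬(t ∈ cs.inversionSet x ↔ x⁻¹ * t * x ∈ cs.inversionSet y) := by
  rw [ht.mem_inversionSet_iff, ht.mem_inversionSet_iff, (ht.conj_inv x).mem_inversionSet_iff,
    mul_inv_rev, signCocycle_mul, inv_inv]
  generalize cs.signCocycle x⁻¹ t = a
  generalize cs.signCocycle y⁻¹ _ = b
  revert a b
  decide

theorem not_mem_inversionSet_one (t : W) : t ∉ cs.inversionSet 1 := fun h => by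
  simpa using h.2

variable {cs} in
theorem IsReflection.mem_inversionSet_self {t : W} (ht : cs.IsReflection t) :
    t ∈ cs.inversionSet t := by
  rw [ht.mem_inversionSet_iff, ht.inv, ht.signCocycle_self]

variable {cs} in
theorem IsReflection.mem_inversionSet_inv {t : W} (ht : cs.IsReflection t) (w : W) :
    t ∈ cs.inversionSet w⁻¹ ↔ w * t * w⁻¹ ∈ cs.inversionSet w := by
  have h := (ht.conj w).mem_inversionSet_mul w w⁻¹
  have e : w⁻¹ * (w * t * w⁻¹) * w = t := by group
  rw [mul_inv_cancel, e] at h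
  have := cs.not_mem_inversionSet_one (w * t * w⁻¹)
  tauto

variable {cs} in
theorem IsReflection.mem_inversionSet_simple {t : W} (ht : cs.IsReflection t) (i : B) :
    t ∈ cs.inversionSet (cs.simple i) ↔ t = cs.simple i := by
  classical
  rw [ht.mem_inversionSet_iff, cs.inv_simple, signCocycle_simple]
  simp

variable {cs} in
theorem IsReflection.mem_inversionSet_conj {t u : W} (ht : cs.IsReflection t)
    (hu : cs.IsReflection u) : t * u * t ∈ cs.inversionSet t ↔ u ∈ cs.inversionSet t := by
  have h := hu.mem_inversionSet_inv t
  rw [ht.inv] at h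
  exact h.symm

variable {cs} in
/-- A reflection has no inversion commuting with it, apart from itself. -/
theorem IsReflection.eq_of_mem_inversionSet_of_conj_eq {t u : W} (ht : cs.IsReflection t)
    (hu : u ∈ cs.inversionSet t) (h : t * u * t = u) : u = t := by
  obtain ⟨w, i, rfl⟩ := ht
  have hv := hu.1.conj_inv w
  have e : cs.simple i * (w⁻¹ * u * w) * cs.simple i = w⁻¹ * u * w := by
    conv_rhs => rw [← h]
    simp [mul_assoc]
  -- Expand N(wsw⁻¹) at u by the cocycle identity. As w⁻¹uw commutes with s, the outer factors w and
  -- w⁻¹ contribute equally and cancel; only N(s) = {s} remains.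
  have h1 := hu.1.mem_inversionSet_mul w (cs.simple i * w⁻¹)
  have h2 := hv.mem_inversionSet_mul (cs.simple i) w⁻¹
  have h3 := hv.mem_inversionSet_inv w
  have h4 := hv.mem_inversionSet_simple i
  have e' : w * (w⁻¹ * u * w) * w⁻¹ = u := by group
  rw [cs.inv_simple, e] at h2
  rw [e'] at h3
  rw [mul_assoc] at hu
  have h5 : w⁻¹ * u * w = cs.simple i := by tauto
  rw [← e', h5]

theorem finite_inversionSet (w : W) : (cs.inversionSet w).Finite := by
  obtain ⟨ω, hω, rfl⟩ := cs.exists_isReduced w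
  refine (List.finite_toSet (cs.leftInvSeq ω)).subset fun t ht => ?_
  refine cs.mem_leftInvSeq_of_signCocycle_ne_zero ω t ?_
  rw [(ht.1.mem_inversionSet_iff _).1 ht]
  exact one_ne_zero

/-! ### Canonical generators of reflection subgroups -/

variable {cs} in
theorem mem_of_mem_canonicalGenerators {W' : Subgroup W} {r : W}
    (hr : r ∈ cs.canonicalGenerators W') : r ∈ W' :=
  (hr.2.ge rfl).2

variable {cs} in
theorem mem_inversionSet_canonicalGenerator_iff {W' : Subgroup W} {r v : W}
    (hr : r ∈ cs.canonicalGenerators W') (hv : v ∈ W') : v ∈ cs.inversionSet r ↔ v = r :=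
  ⟨fun h => hr.2.le ⟨h, hv⟩, fun h => (hr.2.ge h).1⟩

variable {cs} in
theorem mem_inversionSet_mul_canonicalGenerator_iff {W' : Subgroup W} {r v : W}
    (hr : r ∈ cs.canonicalGenerators W') (hv : v ∈ W') (hv' : cs.IsReflection v) (w : W) :
    v ∈ cs.inversionSet (r * w) ↔ ¬(v = r ↔ r * v * r ∈ cs.inversionSet w) := by
  have h := hv'.mem_inversionSet_mul r w
  rwa [hr.1.inv, mem_inversionSet_canonicalGenerator_iff hr hv] at h

/-- Build w letter by letter: the step from y to ys adds the single inversion q = ysy⁻¹. The first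
such q to fall in W' is canonical. -/
theorem exists_canonicalGenerator_mem_inversionSet (W' : Subgroup W) (w t : W)
    (ht : t ∈ cs.inversionSet w) (htW : t ∈ W') :
    ∃ r ∈ cs.canonicalGenerators W', r ∈ cs.inversionSet w := by
  induction hn : cs.length w using Nat.strong_induction_on generalizing w t with
  | _ n ih =>
    subst hn
    have hw : w ≠ 1 := by
      rintro rfl
      exact cs.not_mem_inversionSet_one t ht
    obtain ⟨i, hi⟩ := cs.exists_rightDescent_of_ne_one hw
    obtain ⟨y, rfl⟩ : ∃ y, w = y * cs.simple i := ⟨w * cs.simple i, by simp⟩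
    have hy : cs.length y < cs.length (y * cs.simple i) := by
      simpa [IsRightDescent] using hi
    set q := y * cs.simple i * y⁻¹ with hq
    have hqr : cs.IsReflection q := (cs.isReflection_simple i).conj y
    have hN : ∀ v, cs.IsReflection v →
        (v ∈ cs.inversionSet (y * cs.simple i) ↔ ¬(v ∈ cs.inversionSet y ↔ v = q)) := by
      intro v hv
      rw [hv.mem_inversionSet_mul, (hv.conj_inv y).mem_inversionSet_simple, hq,
        eq_mul_inv_iff_mul_eq, mul_assoc, inv_mul_eq_iff_eq_mul]
    have hqy : q ∈ cs.inversionSet (y * cs.simple i) :=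
      ⟨hqr, by simpa [hq, mul_assoc] using hy⟩
    by_cases hex : ∃ v ∈ cs.inversionSet y, v ∈ W'
    · obtain ⟨v, hv, hvW⟩ := hex
      obtain ⟨r, hr, hry⟩ := ih _ hy y v hv hvW rfl
      refine ⟨r, hr, ?_⟩
      have h1 := hN r hr.1
      have h2 := hN q hqr
      by_cases h : r = q
      · exact h ▸ hqy
      · tauto
    · have hno : ∀ v ∈ W', v ∉ cs.inversionSet y := fun v hv h => hex ⟨v, h, hv⟩
      have htq : t = q := by
        have h1 := hN t ht.1
        have h2 := hno t htW
        tauto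
      subst htq
      refine ⟨q, ⟨hqr, ?_⟩, hqy⟩
      ext v
      refine ⟨fun ⟨hv, hvW⟩ => ?_, ?_⟩
      · have hv1 := hv.1
        have e : q = (y * cs.simple i) * y⁻¹ := hq
        -- Since q = (ys)y⁻¹, an inversion v of q in W' is an inversion of ys or makes qvq an
        -- inversion of y. The latter is excluded because N(y) misses W'.
        have h1 := hv1.mem_inversionSet_mul (y * cs.simple i) y⁻¹
        rw [← e, (hv1.conj_inv _).mem_inversionSet_inv] at h1
        have e2 : y * ((y * cs.simple i)⁻¹ * v * (y * cs.simple i)) * y⁻¹ = q * v * q := by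
          rw [hq]
          simp [mul_assoc]
        rw [e2] at h1
        have h2 := hno _ (mul_mem (mul_mem htW hvW) htW)
        have h3 := hN v hv1
        have h4 := hno v hvW
        exact (show v = q by tauto)
      · rintro rfl
        exact ⟨hqr.mem_inversionSet_self, htW⟩

variable {cs} in
theorem IsReflection.conj_conj {r : W} (hr : cs.IsReflection r) (x : W) :
    r * (r * x * r) * r = x := by
  simp only [mul_assoc, hr.mul_self, mul_one]
  rw [← mul_assoc, hr.mul_self, one_mul]

variable {cs} in
-- Length drops twice, from t to rt and from rt to rtr = (rtrtr)(rt). For the second drop, rtrtr ∈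
-- N(rt) follows from trt ∈ N(t) by the cocycle identity.
theorem IsReflection.length_conj_canonicalGenerator_lt {t r : W} (ht : cs.IsReflection t)
    {W' : Subgroup W} (htW : t ∈ W') (hr : r ∈ cs.canonicalGenerators W')
    (hrt : r ∈ cs.inversionSet t) (hne : r ≠ t) : cs.length (r * t * r) < cs.length t := by
  refine lt_trans ?_ hrt.2
  have hrW := mem_of_mem_canonicalGenerators hr
  have hrr := hr.1.mul_self
  have htt := ht.mul_self
  have hv : cs.IsReflection (r * (t * r * t) * r) := (hr.1.conj_mul ht).conj_mul hr.1
  have hvW : r * (t * r * t) * r ∈ W' := by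
    exact mul_mem (mul_mem hrW (mul_mem (mul_mem htW hrW) htW)) hrW
  have h := mem_inversionSet_mul_canonicalGenerator_iff hr hvW hv t
  have e1 : r * (r * (t * r * t) * r) * r = t * r * t := hr.1.conj_conj _
  rw [e1, ht.mem_inversionSet_conj hr.1] at h
  have hne' : r * (t * r * t) * r ≠ r := by
    intro h1
    have h2 : t * r * t = r := by rw [← e1, h1, hrr, one_mul]
    exact hne (ht.eq_of_mem_inversionSet_of_conj_eq hrt h2)
  have h3 : r * (t * r * t) * r ∈ cs.inversionSet (r * t) := by tauto
  have h4 := h3.2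
  have e2 : r * (t * r * t) * r * (r * t) = r * t * r := by
    rw [mul_assoc _ r, ← mul_assoc r r t, hrr, one_mul, mul_assoc, mul_assoc _ t t, htt, mul_one,
      mul_assoc]
  rwa [e2] at h4

variable {cs} in
theorem IsReflection.mem_closure_canonicalGenerators {t : W} (ht : cs.IsReflection t)
    {W' : Subgroup W} (htW : t ∈ W') : t ∈ Subgroup.closure (cs.canonicalGenerators W') := by
  induction hn : cs.length t using Nat.strong_induction_on generalizing t with
  | _ n ih =>
    subst hn
    obtain ⟨r, hr, hrt⟩ :=
      cs.exists_canonicalGenerator_mem_inversionSet W' t t ht.mem_inversionSet_self htW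
    have hrc := Subgroup.subset_closure hr
    by_cases hne : r = t
    · exact hne ▸ hrc
    · have hrW := mem_of_mem_canonicalGenerators hr
      have h := ih _ (ht.length_conj_canonicalGenerator_lt htW hr hrt hne) (ht.conj_mul hr.1)
        (mul_mem (mul_mem hrW htW) hrW) rfl
      rw [← hr.1.conj_conj t]
      exact mul_mem (mul_mem hrc h) hrc

variable {cs} in
/-- A reflection subgroup is generated by its canonical generators. -/
theorem IsReflectionSubgroup.closure_canonicalGenerators {W' : Subgroup W}
    (h : cs.IsReflectionSubgroup W') : Subgroup.closure (cs.canonicalGenerators W') = W' := by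
  refine le_antisymm ((Subgroup.closure_le _).2 fun r hr => mem_of_mem_canonicalGenerators hr) ?_
  conv_lhs => rw [← h]
  exact (Subgroup.closure_le _).2 fun t ht =>
    IsReflection.mem_closure_canonicalGenerators ht.2 ht.1

/-! ### Dihedral reflection subgroups -/

section Dihedral

variable {cs} {t u : W}

theorem IsReflection.isReflectionSubgroup_closure_pair (ht : cs.IsReflection t)
    (hu : cs.IsReflection u) : cs.IsReflectionSubgroup (Subgroup.closure {t, u}) := by
  refine le_antisymm ((Subgroup.closure_le _).2 fun _ h => h.1) ((Subgroup.closure_le _).2 ?_)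
  rintro x hx
  refine Subgroup.subset_closure ⟨Subgroup.subset_closure hx, ?_⟩
  rcases hx with rfl | rfl
  · exact ht
  · exact hu

theorem IsReflection.mul_zpow_mul_self (ht : cs.IsReflection t) (hu : cs.IsReflection u)
    (k : ℤ) : t * (t * u) ^ k = (t * u) ^ (-k) * t := by
  have h : SemiconjBy t (t * u) (t * u)⁻¹ := by
    rw [SemiconjBy, mul_inv_rev, ht.inv, hu.inv, ← mul_assoc, ht.mul_self, one_mul, mul_assoc,
      ht.mul_self, mul_one]
  have := h.zpow_right k
  rw [inv_zpow'] at this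
  exact this

theorem IsReflection.exists_zpow_of_mem_closure_pair (ht : cs.IsReflection t)
    (hu : cs.IsReflection u) {g : W} (hg : g ∈ Subgroup.closure {t, u}) :
    ∃ k : ℤ, g = (t * u) ^ k ∨ g = (t * u) ^ k * t := by
  have hu' : u = (t * u) ^ (-1 : ℤ) * t := by
    rw [zpow_neg_one, mul_inv_rev, ht.inv, hu.inv, mul_assoc, ht.mul_self, mul_one]
  have hmul : ∀ x y : W, (∃ k : ℤ, x = (t * u) ^ k ∨ x = (t * u) ^ k * t) →
      (∃ k : ℤ, y = (t * u) ^ k ∨ y = (t * u) ^ k * t) →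
      ∃ k : ℤ, x * y = (t * u) ^ k ∨ x * y = (t * u) ^ k * t := by
    rintro x y ⟨k, rfl | rfl⟩ ⟨l, rfl | rfl⟩
    · exact ⟨k + l, Or.inl (zpow_add _ _ _).symm⟩
    · exact ⟨k + l, Or.inr (by rw [zpow_add, mul_assoc])⟩
    · exact ⟨k + -l, Or.inr (by
        rw [mul_assoc, ht.mul_zpow_mul_self hu, ← mul_assoc, zpow_add])⟩
    · exact ⟨k + -l, Or.inl (by
        rw [mul_assoc, ← mul_assoc t, ht.mul_zpow_mul_self hu, mul_assoc, ht.mul_self, mul_one,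
          zpow_add])⟩
  induction hg using Subgroup.closure_induction with
  | mem x hx =>
    rcases hx with rfl | rfl
    · exact ⟨0, Or.inr (by simp)⟩
    · exact ⟨-1, Or.inr hu'⟩
  | one => exact ⟨0, Or.inl (by simp)⟩
  | mul x y _ _ hx hy => exact hmul x y hx hy
  | inv x _ hx =>
    obtain ⟨k, rfl | rfl⟩ := hx
    · exact ⟨-k, Or.inl (zpow_neg _ _).symm⟩
    · exact ⟨k, Or.inr (by
        rw [mul_inv_rev, ht.inv, ← zpow_neg, ht.mul_zpow_mul_self hu, neg_neg])⟩

/-- Reflections have odd length parity, while powers of tu have even parity. -/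
theorem IsReflection.not_isReflection_zpow (ht : cs.IsReflection t) (hu : cs.IsReflection u)
    (k : ℤ) : ¬cs.IsReflection ((t * u) ^ k) := by
  have h2 : ∀ x : W, cs.IsReflection x → cs.lengthParity x = Multiplicative.ofAdd 1 := by
    rintro x ⟨w, i, rfl⟩
    simp [lengthParity_simple]
  intro h
  have h1 := h2 _ h
  rw [map_zpow, map_mul, h2 t ht, h2 u hu, ← ofAdd_add,
    show (1 : ZMod 2) + 1 = 0 by decide, ofAdd_zero, one_zpow] at h1
  exact absurd h1 (by decide)

theorem IsReflection.exists_zpow_mul_of_mem_closure_pair (ht : cs.IsReflection t)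
    (hu : cs.IsReflection u) {g : W} (hg : g ∈ Subgroup.closure {t, u})
    (hgr : cs.IsReflection g) : ∃ k : ℤ, g = (t * u) ^ k * t := by
  obtain ⟨k, rfl | rfl⟩ := ht.exists_zpow_of_mem_closure_pair hu hg
  · exact absurd hgr (ht.not_isReflection_zpow hu k)
  · exact ⟨k, rfl⟩

theorem IsReflection.zpow_triple_mul (ht : cs.IsReflection t) (hu : cs.IsReflection u)
    (a b c : ℤ) : (t * u) ^ a * t * ((t * u) ^ b * t) * ((t * u) ^ c * t) =
      (t * u) ^ (a - b + c) * t := by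
  have h : (t * u) ^ a * t * ((t * u) ^ b * t) = (t * u) ^ (a - b) := by
    rw [mul_assoc, ← mul_assoc t, ht.mul_zpow_mul_self hu, mul_assoc, ht.mul_self, mul_one,
      sub_eq_add_neg, zpow_add]
  rw [h, ← mul_assoc, ← zpow_add]

theorem IsReflection.triple_mul_comm (ht : cs.IsReflection t) (hu : cs.IsReflection u)
    {x y z : W} (hx : x ∈ Subgroup.closure {t, u}) (hy : y ∈ Subgroup.closure {t, u})
    (hz : z ∈ Subgroup.closure {t, u}) (hx' : cs.IsReflection x) (hy' : cs.IsReflection y)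
    (hz' : cs.IsReflection z) : x * y * z = z * y * x := by
  obtain ⟨a, rfl⟩ := ht.exists_zpow_mul_of_mem_closure_pair hu hx hx'
  obtain ⟨b, rfl⟩ := ht.exists_zpow_mul_of_mem_closure_pair hu hy hy'
  obtain ⟨c, rfl⟩ := ht.exists_zpow_mul_of_mem_closure_pair hu hz hz'
  rw [ht.zpow_triple_mul hu, ht.zpow_triple_mul hu]
  congr 2
  ring

/-- If rqr = s, then r ∉ N(rqr), hence r ∈ N(qr), hence qrq ∈ N(r) and qrq = r. Then r and q
commute, so s = q. -/
theorem conj_canonicalGenerator_ne {W' : Subgroup W} {r s q : W}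
    (hr : r ∈ cs.canonicalGenerators W') (hs : s ∈ cs.canonicalGenerators W')
    (hq : q ∈ cs.canonicalGenerators W') (hrs : r ≠ s) (hrq : r ≠ q) (hsq : s ≠ q) :
    r * q * r ≠ s := by
  intro h
  have hrW := mem_of_mem_canonicalGenerators hr
  have hqW := mem_of_mem_canonicalGenerators hq
  have h1 := mem_inversionSet_mul_canonicalGenerator_iff hr hrW hr.1 (q * r)
  rw [hr.1.mul_self, one_mul, mem_inversionSet_mul_canonicalGenerator_iff hq hrW hr.1,
    mem_inversionSet_canonicalGenerator_iff hr (mul_mem (mul_mem hqW hrW) hqW),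
    ← mul_assoc, h, mem_inversionSet_canonicalGenerator_iff hs hrW] at h1
  have h2 : q * r * q = r := by tauto
  apply hsq
  have h3 : r * q = q * r := by
    conv_lhs => rw [← h2]
    rw [mul_assoc, hq.1.mul_self, mul_one]
  rw [← h, h3, mul_assoc, hr.1.mul_self, mul_one]

/-- Evaluate N at q on both sides of qrs = srq. On the left q is an inversion, since q ∉ N(rs); on
the right this forces rsqsr = q. Combined with rsq = qsr it yields srsr = 1. -/
theorem IsReflection.canonicalGenerators_commute (ht : cs.IsReflection t)
    (hu : cs.IsReflection u) {r s q : W}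
    (hr : r ∈ cs.canonicalGenerators (Subgroup.closure {t, u}))
    (hs : s ∈ cs.canonicalGenerators (Subgroup.closure {t, u}))
    (hq : q ∈ cs.canonicalGenerators (Subgroup.closure {t, u}))
    (hrs : r ≠ s) (hrq : r ≠ q) (hsq : s ≠ q) : r * s = s * r := by
  have hrW := mem_of_mem_canonicalGenerators hr
  have hsW := mem_of_mem_canonicalGenerators hs
  have hqW := mem_of_mem_canonicalGenerators hq
  have e1 : s * r * q = q * r * s := ht.triple_mul_comm hu hsW hrW hqW hs.1 hr.1 hq.1
  have e2 : r * s * q = q * s * r := ht.triple_mul_comm hu hrW hsW hqW hr.1 hs.1 hq.1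
  have n1 := conj_canonicalGenerator_ne hr hs hq hrs hrq hsq
  have n2 := conj_canonicalGenerator_ne hs hr hq hrs.symm hsq hrq
  have h1 := mem_inversionSet_mul_canonicalGenerator_iff hq hqW hq.1 (r * s)
  rw [hq.1.mul_self, one_mul, mem_inversionSet_mul_canonicalGenerator_iff hr hqW hq.1,
    mem_inversionSet_canonicalGenerator_iff hs (mul_mem (mul_mem hrW hqW) hrW),
    ← mul_assoc, ← e1, mul_assoc, mem_inversionSet_mul_canonicalGenerator_iff hs hqW hq.1,
    mem_inversionSet_mul_canonicalGenerator_iff hr (mul_mem (mul_mem hsW hqW) hsW)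
      (hq.1.conj_mul hs.1), mem_inversionSet_canonicalGenerator_iff hq
      (mul_mem (mul_mem hrW (mul_mem (mul_mem hsW hqW) hsW)) hrW)] at h1
  have h2 : r * (s * q * s) * r = q := by
    have := hrq.symm
    have := hsq.symm
    tauto
  have h3 : q * (s * r * s * r) = q * 1 := by
    rw [mul_one]
    conv_rhs => rw [← h2]
    rw [show r * (s * q * s) * r = r * s * q * (s * r) by simp only [mul_assoc], e2]
    simp only [mul_assoc]
  have h4 := mul_left_cancel h3
  rw [mul_assoc (s * r)] at h4
  rw [← inv_eq_of_mul_eq_one_left h4, mul_inv_rev, hs.1.inv, hr.1.inv]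

/-- The subgroup generated by two distinct reflections has exactly two canonical generators. -/
theorem IsReflection.exists_canonicalGenerators_eq_pair (ht : cs.IsReflection t)
    (hu : cs.IsReflection u) (htu : t ≠ u) :
    ∃ r s : W, r ≠ s ∧ cs.canonicalGenerators (Subgroup.closure {t, u}) = {r, s} := by
  set W' := Subgroup.closure {t, u} with hW'
  have hgen : Subgroup.closure (cs.canonicalGenerators W') = W' :=
    (ht.isReflectionSubgroup_closure_pair hu).closure_canonicalGenerators
  have htW : t ∈ W' := Subgroup.subset_closure (by simp)
  have huW : u ∈ W' := Subgroup.subset_closure (by simp)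
  have hne1 : ∀ x : W, cs.IsReflection x → x ≠ 1 := by
    rintro x hx rfl
    simpa using hx.odd_length
  obtain ⟨r, hr, hrt⟩ :=
    cs.exists_canonicalGenerator_mem_inversionSet W' t t ht.mem_inversionSet_self htW
  -- With r as the only canonical generator, W' would be {1, r}, too small for both t and u.
  obtain ⟨s, hs, hrs⟩ : ∃ s ∈ cs.canonicalGenerators W', r ≠ s := by
    by_contra! h
    have hz : ∀ x ∈ W', x = 1 ∨ x = r := by
      intro x hx
      rw [← hgen] at hx
      induction hx using Subgroup.closure_induction with
      | mem x hx => exact Or.inr (h x hx).symm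
      | one => exact Or.inl rfl
      | mul x y _ _ hx hy =>
        rcases hx with rfl | rfl <;> rcases hy with rfl | rfl <;> simp [hr.1.mul_self]
      | inv x _ hx => rcases hx with rfl | rfl <;> simp [hr.1.inv]
    exact htu (((hz t htW).resolve_left (hne1 t ht)).trans
      ((hz u huW).resolve_left (hne1 u hu)).symm)
  -- A third canonical generator would make all of them commute. Then W' is abelian, (tu)² = 1, and
  -- the only reflections in W' are t and tut.
  refine ⟨r, s, hrs, Set.Subset.antisymm (fun q hq => ?_) ?_⟩
  · by_contra hqn
    have hqr : r ≠ q := fun h => hqn (by simp [h])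
    have hqs : s ≠ q := fun h => hqn (by simp [h])
    have hcomm : ∀ x ∈ cs.canonicalGenerators W', ∀ y ∈ cs.canonicalGenerators W',
        x * y = y * x := by
      intro x hx y hy
      by_cases hxy : x = y
      · rw [hxy]
      · obtain ⟨z, hz, hxz, hyz⟩ : ∃ z ∈ cs.canonicalGenerators W', x ≠ z ∧ y ≠ z := by
          by_contra! hz
          have h1 := or_iff_not_imp_left.2 (hz r hr)
          have h2 := or_iff_not_imp_left.2 (hz s hs)
          have h3 := or_iff_not_imp_left.2 (hz q hq)
          grind
        exact ht.canonicalGenerators_commute hu hx hy hz hxy hxz hyz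
    have hab : ∀ x ∈ W', ∀ y ∈ W', x * y = y * x := by
      intro x hx y hy
      rw [← hgen] at hx hy
      exact Subgroup.closure_induction₂ (p := fun x y _ _ => x * y = y * x)
        (fun x y hx hy => hcomm x hx y hy) (by simp) (by simp)
        (fun _ _ _ _ _ _ h1 h2 => Commute.mul_left h1 h2)
        (fun _ _ _ _ _ _ h1 h2 => Commute.mul_right h1 h2)
        (fun _ _ _ _ h => Commute.inv_left h) (fun _ _ _ _ h => Commute.inv_right h) hx hy
    have hsq : (t * u) ^ (2 : ℤ) = 1 := by
      rw [zpow_two, mul_assoc, ← mul_assoc u, hab u huW t htW, mul_assoc, hu.mul_self, mul_one,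
        ht.mul_self]
    have hvals : ∀ x ∈ W', cs.IsReflection x → x = t ∨ x = t * u * t := by
      intro x hx hxr
      obtain ⟨k, rfl⟩ := ht.exists_zpow_mul_of_mem_closure_pair hu hx hxr
      rcases Int.even_or_odd' k with ⟨l, rfl | rfl⟩
      · left
        rw [zpow_mul, hsq, one_zpow, one_mul]
      · right
        rw [zpow_add, zpow_mul, hsq, one_zpow, one_mul, zpow_one]
    have h1 := hvals r (mem_of_mem_canonicalGenerators hr) hr.1
    have h2 := hvals s (mem_of_mem_canonicalGenerators hs) hs.1
    have h3 := hvals q (mem_of_mem_canonicalGenerators hq) hq.1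
    grind
  · rintro x (rfl | rfl)
    · exact hr
    · exact hs

end Dihedral

/-! ### Alternating reflections -/

section Alternating

variable {cs} (r s : cs.reflections)

theorem coe_alternating_eq_zpow (i : ℕ) :
    (alternating r s i : W) = ((r : W) * s) ^ (i : ℤ) * r := by
  rw [zpow_natCast]
  rfl

theorem coe_alternating_swap_eq_zpow (i : ℕ) :
    (alternating s r i : W) = ((r : W) * s) ^ (-(i + 1) : ℤ) * r := by
  have h : (s : W) * r = ((r : W) * s)⁻¹ := by rw [mul_inv_rev, r.2.inv, s.2.inv]
  rw [coe_alternating_eq_zpow, h, inv_zpow', neg_add, zpow_add, mul_assoc, zpow_neg_one,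
    mul_inv_rev, r.2.inv, s.2.inv, mul_assoc, r.2.mul_self, mul_one]

theorem alternating_zero : alternating r s 0 = r := by
  ext
  simp [alternating]

theorem conj_alternating (i : ℕ) :
    (r : W) * alternating s r i * r = alternating r s (i + 1) := by
  have h := r.2.zpow_triple_mul s.2 0 (-(i + 1) : ℤ) 0
  rw [zpow_zero, one_mul, ← coe_alternating_swap_eq_zpow] at h
  rw [h, coe_alternating_eq_zpow]
  congr 2
  push_cast
  ring

theorem conj_eq_alternating_iff (v : W) (i : ℕ) :
    (r : W) * v * r = alternating s r i ↔ v = alternating r s (i + 1) := by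
  rw [← conj_alternating]
  constructor
  · intro h
    rw [← h, r.2.conj_conj]
  · rintro rfl
    rw [r.2.conj_conj]

theorem alternating_triple (a b : ℕ) (h : b ≤ 2 * a) :
    (alternating r s a : W) * alternating r s b * alternating r s a =
      alternating r s (2 * a - b) := by
  simp only [coe_alternating_eq_zpow]
  rw [r.2.zpow_triple_mul s.2]
  congr 2
  omega

theorem alternating_conj_alternating_swap_conj (a : ℕ) :
    (r : W) * (alternating s r a * r * alternating s r a) * r =
      alternating r s (2 * a + 2) := by
  have h := r.2.zpow_triple_mul s.2 (-(a + 1) : ℤ) 0 (-(a + 1) : ℤ)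
  have h' := r.2.zpow_triple_mul s.2 0 (-(a + 1) - 0 + -(a + 1) : ℤ) 0
  rw [zpow_zero, one_mul, ← coe_alternating_swap_eq_zpow] at h
  rw [zpow_zero, one_mul, ← h] at h'
  rw [h', coe_alternating_eq_zpow]
  congr 2
  push_cast
  ring

theorem alternating_mod (i : ℕ) :
    alternating r s (i % orderOf ((r : W) * s)) = alternating r s i := by
  ext
  simp only [alternating, pow_mod_orderOf]

theorem orderOf_mul_swap : orderOf ((s : W) * r) = orderOf ((r : W) * s) := by
  rw [← orderOf_inv, mul_inv_rev, r.2.inv, s.2.inv]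

theorem alternating_swap_eq (i : ℕ) (hi : i < orderOf ((r : W) * s)) :
    alternating s r i = alternating r s (orderOf ((r : W) * s) - 1 - i) := by
  ext
  rw [coe_alternating_swap_eq_zpow, coe_alternating_eq_zpow,
    show ((orderOf ((r : W) * s) - 1 - i : ℕ) : ℤ) = orderOf ((r : W) * s) + (-(i + 1)) by omega,
    zpow_add, zpow_natCast, pow_orderOf_eq_one, one_mul]

theorem alternating_inj {i j : ℕ}
    (hi : orderOf ((r : W) * s) = 0 ∨ i < orderOf ((r : W) * s))
    (hj : orderOf ((r : W) * s) = 0 ∨ j < orderOf ((r : W) * s)) :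
    alternating r s i = alternating r s j ↔ i = j := by
  refine ⟨fun h => ?_, fun h => h ▸ rfl⟩
  have h1 : ((r : W) * s) ^ i = ((r : W) * s) ^ j :=
    mul_right_cancel (congrArg Subtype.val h)
  have h2 := pow_eq_pow_iff_modEq.1 h1
  rcases hi with hi | hi
  · rw [hi] at h2
    exact Nat.modEq_zero_iff.1 h2
  · rcases hj with hj | hj
    · omega
    · exact Nat.ModEq.eq_of_lt_of_lt h2 hi hj

variable {r s}

/-- Every reflection in a dihedral group is alternating, with a small index. -/
theorem exists_alternating_of_mem_closure {v : cs.reflections}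
    (hv : (v : W) ∈ Subgroup.closure {(r : W), (s : W)}) :
    ∃ a, (orderOf ((r : W) * s) = 0 ∨ 2 * a + 1 ≤ orderOf ((r : W) * s)) ∧
      (v = alternating r s a ∨ v = alternating s r a) := by
  obtain ⟨k, hk⟩ := r.2.exists_zpow_mul_of_mem_closure_pair s.2 hv v.2
  by_cases h0 : orderOf ((r : W) * s) = 0
  · rcases k with a | a
    · refine ⟨a, Or.inl h0, Or.inl (Subtype.ext ?_)⟩
      rw [coe_alternating_eq_zpow, hk]
      rfl
    · refine ⟨a, Or.inl h0, Or.inr (Subtype.ext ?_)⟩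
      rw [coe_alternating_swap_eq_zpow, hk, Int.negSucc_eq]
  · have hpos : (0 : ℤ) < orderOf ((r : W) * s) := by omega
    have hk1 := Int.emod_nonneg k hpos.ne'
    have hk2 := Int.emod_lt_of_pos k hpos
    obtain ⟨c, hc⟩ := Int.eq_ofNat_of_zero_le hk1
    have hv : v = alternating r s c := by
      ext
      rw [coe_alternating_eq_zpow, ← hc, zpow_mod_orderOf, hk]
    -- An index beyond the middle of the finite chain is counted from the other end instead.
    by_cases h : 2 * c + 1 ≤ orderOf ((r : W) * s)
    · exact ⟨c, Or.inr h, Or.inl hv⟩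
    · refine ⟨orderOf ((r : W) * s) - 1 - c, Or.inr (by omega), Or.inr ?_⟩
      rw [alternating_swap_eq r s _ (by omega), hv]
      congr 1
      omega

end Alternating

/-! ### Inversions in dihedral reflection subgroups -/

section Sections

variable {cs} {W' : Subgroup W} {r s : cs.reflections}

theorem alternating_mem (hr : (r : W) ∈ W') (hs : (s : W) ∈ W') (i : ℕ) :
    (alternating r s i : W) ∈ W' :=
  mul_mem (pow_mem (mul_mem hr hs) i) hr

theorem mem_inversionSet_iff_alternating_of_mem
    (hr : (r : W) ∈ cs.canonicalGenerators W') {w : W} (hrw : (r : W) ∈ cs.inversionSet w)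
    (ih : ∃ k : ℕ,
      (∀ v ∈ W', cs.IsReflection v →
        (v ∈ cs.inversionSet (r * w) ↔ ∃ i < k, v = alternating r s i)) ∨
      (∀ v ∈ W', cs.IsReflection v →
        (v ∈ cs.inversionSet (r * w) ↔ ∃ i < k, v = alternating s r i))) :
    ∃ k : ℕ, ∀ v ∈ W', cs.IsReflection v →
      (v ∈ cs.inversionSet w ↔ ∃ i < k, v = alternating r s i) := by
  have hrW := mem_of_mem_canonicalGenerators hr
  have hN : ∀ v ∈ W', cs.IsReflection v → (v ∈ cs.inversionSet w ↔
      ¬(v = r ↔ (r : W) * v * r ∈ cs.inversionSet (r * w))) := by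
    intro v hv hv'
    have h := mem_inversionSet_mul_canonicalGenerator_iff hr hv hv' (r * w)
    rwa [← mul_assoc, hr.1.mul_self, one_mul] at h
  have hrN : (r : W) ∉ cs.inversionSet (r * w) := by
    have h := hN r hrW r.2
    rw [hr.1.mul_self, one_mul] at h
    tauto
  obtain ⟨k, h | h⟩ := ih
  -- A nonempty section starting at r would contain r, which is not an inversion of rw.
  · have hk : k = 0 := by
      by_contra hk
      exact hrN ((h r hrW r.2).2 ⟨0, Nat.pos_of_ne_zero hk, by rw [alternating_zero]⟩)
    subst hk
    refine ⟨1, fun v hv hv' => ?_⟩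
    rw [hN v hv hv', h _ (mul_mem (mul_mem hrW hv) hrW) (hv'.conj_mul r.2)]
    simp [alternating_zero]
  · refine ⟨k + 1, fun v hv hv' => ?_⟩
    have h0 : ¬∃ i < k, (r : W) = alternating r s (i + 1) := by
      rintro ⟨i, hi, hri⟩
      refine hrN ((h r hrW r.2).2 ⟨i, hi, ?_⟩)
      rw [← (conj_eq_alternating_iff r s _ i).2 hri, r.2.mul_self, one_mul]
    rw [hN v hv hv', h _ (mul_mem (mul_mem hrW hv) hrW) (hv'.conj_mul r.2)]
    simp only [conj_eq_alternating_iff]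
    have h1 : (∃ i < k + 1, v = alternating r s i) ↔
        v = r ∨ ∃ i < k, v = alternating r s (i + 1) := by
      constructor
      · rintro ⟨i, hi, hv⟩
        rcases i with _ | i
        · exact Or.inl (by rw [hv, alternating_zero])
        · exact Or.inr ⟨i, by omega, hv⟩
      · rintro (hv | ⟨i, hi, hv⟩)
        · exact ⟨0, by omega, by rw [hv, alternating_zero]⟩
        · exact ⟨i + 1, by omega, hv⟩
    rw [h1]
    have h2 : v = r → ¬∃ i < k, v = alternating r s (i + 1) := by
      rintro rfl
      exact h0
    generalize (∃ i < k, v = alternating r s (i + 1)) = P at h2 ⊢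
    tauto

/-- The inversions of `w` in a dihedral reflection subgroup form a section of alternating
reflections. -/
theorem mem_inversionSet_iff_alternating (hχ : cs.canonicalGenerators W' = {(r : W), (s : W)})
    (w : W) : ∃ k : ℕ,
      (∀ v ∈ W', cs.IsReflection v →
        (v ∈ cs.inversionSet w ↔ ∃ i < k, v = alternating r s i)) ∨
      (∀ v ∈ W', cs.IsReflection v →
        (v ∈ cs.inversionSet w ↔ ∃ i < k, v = alternating s r i)) := by
  induction hn : cs.length w using Nat.strong_induction_on generalizing w with
  | _ n ih =>
    subst hn
    by_cases hex : ∃ v ∈ cs.inversionSet w, v ∈ W'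
    · obtain ⟨v, hv, hvW⟩ := hex
      obtain ⟨q, hq, hqw⟩ := cs.exists_canonicalGenerator_mem_inversionSet W' w v hv hvW
      have hr : (r : W) ∈ cs.canonicalGenerators W' := by simp [hχ]
      have hs : (s : W) ∈ cs.canonicalGenerators W' := by simp [hχ]
      rw [hχ] at hq
      rcases hq with rfl | rfl
      · obtain ⟨k, hk⟩ := mem_inversionSet_iff_alternating_of_mem hr hqw (ih _ hqw.2 _ rfl)
        exact ⟨k, Or.inl hk⟩
      · obtain ⟨k, hk⟩ := ih _ hqw.2 _ rfl
        obtain ⟨k, hk⟩ := mem_inversionSet_iff_alternating_of_mem hs hqw ⟨k, hk.symm⟩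
        exact ⟨k, Or.inr hk⟩
    · refine ⟨0, Or.inl fun v hv _ => ?_⟩
      have : v ∉ cs.inversionSet w := fun h => hex ⟨v, h, hv⟩
      simp [this]

/-- Induct through the conjugation of `alternating s r a` by r: the old inversions shift to the
indices 1, …, 2a + 1, and the two factors r add the indices 0 and 2a + 2. The bound on the order
keeps these 2a + 3 reflections distinct, so nothing cancels. -/
theorem mem_inversionSet_alternating_iff (hr : (r : W) ∈ cs.canonicalGenerators W')
    (hs : (s : W) ∈ cs.canonicalGenerators W') {a : ℕ}
    (ha : orderOf ((r : W) * s) = 0 ∨ 2 * a + 1 ≤ orderOf ((r : W) * s))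
    {v : W} (hv : v ∈ W') (hv' : cs.IsReflection v) :
    v ∈ cs.inversionSet (alternating r s a) ↔ ∃ i < 2 * a + 1, v = alternating r s i := by
  induction a generalizing r s v with
  | zero => simp [alternating_zero, mem_inversionSet_canonicalGenerator_iff hr hv]
  | succ a ih =>
    have hrW := mem_of_mem_canonicalGenerators hr
    have hsW := mem_of_mem_canonicalGenerators hs
    have hη := alternating_mem hsW hrW a
    have hrv : (r : W) * v * r ∈ W' := mul_mem (mul_mem hrW hv) hrW
    have hrv' := hv'.conj_mul r.2
    rw [← orderOf_mul_swap] at ha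
    have h1 := (hrv'.mem_inversionSet_mul (alternating s r a : W) r)
    rw [(alternating s r a).2.inv, ih hs hr (by omega) hrv hrv',
      mem_inversionSet_canonicalGenerator_iff hr (mul_mem (mul_mem hη hrv) hη)] at h1
    have h2 : (alternating s r a : W) * (r * v * r) * alternating s r a = r ↔
        v = alternating r s (2 * a + 2) := by
      rw [← alternating_conj_alternating_swap_conj]
      constructor
      · intro h
        conv_lhs => rw [← r.2.conj_conj v, ← (alternating s r a).2.conj_conj ((r : W) * v * r), h]
      · rintro rfl
        rw [r.2.conj_conj, (alternating s r a).2.conj_conj]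
    simp only [conj_eq_alternating_iff] at h1
    rw [h2] at h1
    rw [← conj_alternating, mul_assoc,
      mem_inversionSet_mul_canonicalGenerator_iff hr hv hv', h1]
    rw [orderOf_mul_swap] at ha
    have hinj : ∀ i j, i < 2 * a + 3 → j < 2 * a + 3 →
        (alternating r s i : W) = alternating r s j → i = j := by
      intro i j hi hj h
      have hi' : orderOf ((r : W) * s) = 0 ∨ i < orderOf ((r : W) * s) :=
        ha.imp_right fun h' => by omega
      have hj' : orderOf ((r : W) * s) = 0 ∨ j < orderOf ((r : W) * s) :=
        ha.imp_right fun h' => by omega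
      exact (alternating_inj r s hi' hj').1 (Subtype.ext h)
    have h3 : v = r ↔ v = alternating r s 0 := by rw [alternating_zero]
    rw [h3]
    constructor
    · intro h
      by_cases h4 : v = alternating r s 0
      · exact ⟨0, by omega, h4⟩
      · by_cases h5 : v = alternating r s (2 * a + 2)
        · exact ⟨_, by omega, h5⟩
        · obtain ⟨i, hi, hvi⟩ : ∃ i < 2 * a + 1, v = alternating r s (i + 1) := by tauto
          exact ⟨i + 1, by omega, hvi⟩
    · rintro ⟨i, hi, rfl⟩
      have h4 : (alternating r s i : W) = alternating r s 0 ↔ i = 0 :=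
        ⟨fun h => hinj _ _ (by omega) (by omega) h, fun h => by rw [h]⟩
      have h5 : (alternating r s i : W) = alternating r s (2 * a + 2) ↔ i = 2 * a + 2 :=
        ⟨fun h => hinj _ _ (by omega) (by omega) h, fun h => by rw [h]⟩
      have h6 : (∃ j < 2 * a + 1, (alternating r s i : W) = alternating r s (j + 1)) ↔
          1 ≤ i ∧ i ≤ 2 * a + 1 := by
        constructor
        · rintro ⟨j, hj, h⟩
          have := hinj _ _ (by omega) (by omega) h
          omega
        · rintro ⟨h, h'⟩
          exact ⟨i - 1, by omega, by rw [Nat.sub_add_cancel h]⟩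
      rw [h4, h5, h6]
      omega

end Sections

/-! ### Dihedral subgroups in a reflection order -/

section Order

variable {cs} {lt : cs.reflections → cs.reflections → Prop} {W' : Subgroup W}
  {r s : cs.reflections}

theorem IsDihedralChain.swap (h : IsDihedralChain lt r s) :
    IsDihedralChain (Function.swap lt) s r := by
  constructor
  · rw [orderOf_mul_swap]
    intro h0 i j hij hj
    rw [Function.swap, alternating_swap_eq r s i (by omega), alternating_swap_eq r s j hj]
    exact h.finite_order h0 _ _ (by omega) (by omega)
  · rw [orderOf_mul_swap]
    intro h0
    obtain ⟨h1, h2, h3⟩ := h.infinite_order h0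
    exact ⟨h2, h1, fun i j => h3 j i⟩

theorem IsDihedralChain.lt_alternating (h : IsDihedralChain lt r s) {i j : ℕ} (hij : i < j)
    (hj : orderOf ((r : W) * s) = 0 ∨ j < orderOf ((r : W) * s)) :
    lt (alternating r s i) (alternating r s j) := by
  by_cases h0 : orderOf ((r : W) * s) = 0
  · exact (h.infinite_order h0).1 i j hij
  · exact h.finite_order h0 i j hij (hj.resolve_left h0)

theorem IsDihedralChain.exists_alternating_of_lt (h : IsDihedralChain lt r s)
    (hlt : ∀ x y, lt x y → ¬lt y x) {x : cs.reflections}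
    (hx : (x : W) ∈ Subgroup.closure {(r : W), (s : W)}) {i k : ℕ} (hi : i < k)
    (hxi : lt x (alternating r s i)) : ∃ j < k, x = alternating r s j := by
  obtain ⟨a, ha, hxa⟩ := exists_alternating_of_mem_closure hx
  by_cases h0 : orderOf ((r : W) * s) = 0
  · rcases hxa with rfl | rfl
    · refine ⟨a, ?_, rfl⟩
      by_contra hka
      exact hlt _ _ hxi (h.lt_alternating (by omega) (Or.inl h0))
    · exact absurd hxi (hlt _ _ ((h.infinite_order h0).2.2 _ _))
  · obtain ⟨b, hb, rfl⟩ : ∃ b < orderOf ((r : W) * s), x = alternating r s b := by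
      rcases hxa with rfl | rfl
      · exact ⟨a, by omega, rfl⟩
      · exact ⟨_, by omega, alternating_swap_eq r s a (by omega)⟩
    refine ⟨b, ?_, rfl⟩
    by_contra hkb
    -- The index i may exceed the order of rs, so it is first reduced; this can only lower it.
    have him := Nat.mod_le i (orderOf ((r : W) * s))
    rw [← alternating_mod r s i] at hxi
    exact hlt _ _ hxi (h.lt_alternating (by omega) (Or.inr hb))

/-- Here t lies in the half of the chain that starts at r. Its inversions in W' have indices 0, …,
2a, and conjugation by t reflects b to 2a - b about the index a of t. Everything below t is an
inversion of t, so non-inversions lie above. -/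
theorem IsDihedralChain.position_alternating (h : IsDihedralChain lt r s)
    (hlt : IsStrictTotalOrder cs.reflections lt)
    (hr : (r : W) ∈ cs.canonicalGenerators W') (hs : (s : W) ∈ cs.canonicalGenerators W')
    (hgen : Subgroup.closure {(r : W), (s : W)} = W') {a : ℕ}
    (ha : orderOf ((r : W) * s) = 0 ∨ 2 * a + 1 ≤ orderOf ((r : W) * s))
    {t u u' : cs.reflections} (hta : t = alternating r s a) (hu : (u : W) ∈ W') (hut : u ≠ t)
    (hu' : (u' : W) = t * u * t) :
    ((u : W) ∈ cs.inversionSet t → (lt u t ∧ lt t u') ∨ (lt u' t ∧ lt t u)) ∧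
    ((u : W) ∉ cs.inversionSet t → lt t u ∧ lt t u') := by
  have hrW := mem_of_mem_canonicalGenerators hr
  have hsW := mem_of_mem_canonicalGenerators hs
  have htW : (t : W) ∈ W' := hta ▸ alternating_mem hrW hsW a
  have hu'W : (u' : W) ∈ W' := hu' ▸ mul_mem (mul_mem htW hu) htW
  constructor
  · intro hN
    rw [hta, mem_inversionSet_alternating_iff hr hs ha hu u.2] at hN
    obtain ⟨b, hb, hub⟩ := hN
    have hub' : u = alternating r s b := Subtype.ext hub
    have hu'b : u' = alternating r s (2 * a - b) := by
      ext
      rw [hu', hta, hub, alternating_triple r s a b (by omega)]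
    have hba : b ≠ a := by
      rintro rfl
      exact hut (hub'.trans hta.symm)
    rw [hta, hub', hu'b]
    rcases lt_or_gt_of_ne hba with hlt' | hlt'
    · exact Or.inl ⟨h.lt_alternating hlt' (by omega), h.lt_alternating (by omega) (by omega)⟩
    · exact Or.inr ⟨h.lt_alternating (by omega) (by omega), h.lt_alternating hlt' (by omega)⟩
  · have key : ∀ v : cs.reflections, (v : W) ∈ W' → v ≠ t → (v : W) ∉ cs.inversionSet t →
        lt t v := by
      intro v hv hvt hN
      rcases trichotomous_of lt t v with h1 | h1 | h1
      · exact h1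
      · exact absurd h1.symm hvt
      · exfalso
        apply hN
        rw [hta] at h1
        obtain ⟨j, hj, hvj⟩ := h.exists_alternating_of_lt (fun x y => asymm_of lt)
          (hgen ▸ hv) (show a < 2 * a + 1 by omega) h1
        rw [hta, mem_inversionSet_alternating_iff hr hs ha hv v.2]
        exact ⟨j, hj, by rw [hvj]⟩
    intro hN
    refine ⟨key u hu hut hN, key u' hu'W ?_ ?_⟩
    · rintro rfl
      apply hut
      ext
      rw [mul_assoc, left_eq_mul] at hu'
      rw [← mul_one (u : W), ← u'.2.mul_self, ← mul_assoc, hu', one_mul]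
    · rwa [hu', t.2.mem_inversionSet_conj u.2]

theorem IsDihedralChain.position (h : IsDihedralChain lt r s)
    (hlt : IsStrictTotalOrder cs.reflections lt)
    (hχ : cs.canonicalGenerators W' = {(r : W), (s : W)})
    (hgen : Subgroup.closure {(r : W), (s : W)} = W')
    {t u u' : cs.reflections} (ht : (t : W) ∈ W') (hu : (u : W) ∈ W') (hut : u ≠ t)
    (hu' : (u' : W) = t * u * t) :
    ((u : W) ∈ cs.inversionSet t → (lt u t ∧ lt t u') ∨ (lt u' t ∧ lt t u)) ∧
    ((u : W) ∉ cs.inversionSet t → (lt t u ∧ lt t u') ∨ (lt u t ∧ lt u' t)) := by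
  have hr : (r : W) ∈ cs.canonicalGenerators W' := by simp [hχ]
  have hs : (s : W) ∈ cs.canonicalGenerators W' := by simp [hχ]
  obtain ⟨a, ha, hta | hta⟩ := exists_alternating_of_mem_closure (hgen.symm ▸ ht)
  · obtain ⟨h1, h2⟩ := h.position_alternating hlt hr hs hgen ha hta hu hut hu'
    exact ⟨h1, fun hN => Or.inl (h2 hN)⟩
  -- When t lies in the half starting at s, reverse the order and exchange r and s.
  · have hlt' : IsStrictTotalOrder cs.reflections (Function.swap lt) :=
      inferInstance
    rw [← orderOf_mul_swap] at ha
    obtain ⟨h1, h2⟩ := h.swap.position_alternating hlt' hs hr (by rwa [Set.pair_comm]) ha hta hu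
      hut hu'
    refine ⟨fun hN => ?_, fun hN => Or.inr (h2 hN)⟩
    have := h1 hN
    simp only [Function.swap] at this
    tauto

theorem IsDihedralChain.inversionSet_section (h : IsDihedralChain lt r s)
    (hlt : IsStrictTotalOrder cs.reflections lt)
    (hχ : cs.canonicalGenerators W' = {(r : W), (s : W)})
    (hgen : Subgroup.closure {(r : W), (s : W)} = W') (w : W) :
    (∀ x y : cs.reflections, (x : W) ∈ W' → (y : W) ∈ W' → lt x y →
      (y : W) ∈ cs.inversionSet w → (x : W) ∈ cs.inversionSet w) ∨
    (∀ x y : cs.reflections, (x : W) ∈ W' → (y : W) ∈ W' → lt x y →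
      (x : W) ∈ cs.inversionSet w → (y : W) ∈ cs.inversionSet w) := by
  obtain ⟨k, hk | hk⟩ := mem_inversionSet_iff_alternating hχ w
  · left
    intro x y hx hy hxy hyw
    obtain ⟨i, hi, hyi⟩ := (hk y hy y.2).1 hyw
    rw [Subtype.ext hyi] at hxy
    obtain ⟨j, hj, hxj⟩ := h.exists_alternating_of_lt (fun x y => asymm_of lt) (hgen ▸ hx) hi hxy
    exact (hk x hx x.2).2 ⟨j, hj, by rw [hxj]⟩
  · right
    intro x y hx hy hxy hxw
    obtain ⟨i, hi, hxi⟩ := (hk x hx x.2).1 hxw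
    rw [Subtype.ext hxi] at hxy
    obtain ⟨j, hj, hyj⟩ := h.swap.exists_alternating_of_lt (fun x y => asymm_of lt)
      (by rwa [Set.pair_comm, hgen]) hi hxy
    exact (hk y hy y.2).2 ⟨j, hj, by rw [hyj]⟩

/-- The relative position, in a reflection order, of a reflection `t`, a reflection `u` and its
conjugate `u' = tut`, and the shape of the inversion sets on these. -/
theorem IsReflectionOrder.position (h : cs.IsReflectionOrder lt) {t u u' : cs.reflections}
    (hut : u ≠ t) (hu' : (u' : W) = t * u * t) :
    ((u : W) ∈ cs.inversionSet t → (lt u t ∧ lt t u') ∨ (lt u' t ∧ lt t u)) ∧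
    ((u : W) ∉ cs.inversionSet t → (lt t u ∧ lt t u') ∨ (lt u t ∧ lt u' t)) ∧
    ∀ w : W,
      (∀ x ∈ ({t, u, u'} : Set cs.reflections), ∀ y ∈ ({t, u, u'} : Set cs.reflections), lt x y →
        (y : W) ∈ cs.inversionSet w → (x : W) ∈ cs.inversionSet w) ∨
      (∀ x ∈ ({t, u, u'} : Set cs.reflections), ∀ y ∈ ({t, u, u'} : Set cs.reflections), lt x y →
        (x : W) ∈ cs.inversionSet w → (y : W) ∈ cs.inversionSet w) := by
  set W' := Subgroup.closure {(t : W), (u : W)} with hW'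
  have htu : (t : W) ≠ u := fun h => hut (Subtype.ext h.symm)
  have hrs := t.2.isReflectionSubgroup_closure_pair u.2
  obtain ⟨r₀, s₀, hne, hχ⟩ := t.2.exists_canonicalGenerators_eq_pair u.2 htu
  have hr : cs.IsReflection r₀ := (hχ.ge (Or.inl rfl)).1
  have hs : cs.IsReflection s₀ := (hχ.ge (Or.inr rfl)).1
  have htW : (t : W) ∈ W' := Subgroup.subset_closure (by simp)
  have huW : (u : W) ∈ W' := Subgroup.subset_closure (by simp)
  have hmem : ∀ x ∈ ({t, u, u'} : Set cs.reflections), (x : W) ∈ W' := by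
    rintro x (rfl | rfl | rfl)
    · exact htW
    · exact huW
    · exact hu' ▸ mul_mem (mul_mem htW huW) htW
  obtain ⟨r, s, hχ', hch⟩ : ∃ r s : cs.reflections,
      cs.canonicalGenerators W' = {(r : W), (s : W)} ∧ IsDihedralChain lt r s := by
    rcases h.dihedral W' hrs ⟨r₀, hr⟩ ⟨s₀, hs⟩ (fun h => hne (congrArg Subtype.val h)) hχ with
      hc | hc
    · exact ⟨⟨r₀, hr⟩, ⟨s₀, hs⟩, hχ, hc⟩
    · exact ⟨⟨s₀, hs⟩, ⟨r₀, hr⟩, hχ.trans (Set.pair_comm _ _), hc⟩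
  have hgen' : Subgroup.closure {(r : W), (s : W)} = W' := by
    rw [← hχ', hrs.closure_canonicalGenerators]
  obtain ⟨h1, h2⟩ := hch.position h.strictTotalOrder hχ' hgen' htW huW hut hu'
  refine ⟨h1, h2, fun w => ?_⟩
  exact (hch.inversionSet_section h.strictTotalOrder hχ' hgen' w).imp
    (fun h3 x hx y hy => h3 x y (hmem x hx) (hmem y hy))
    (fun h3 x hx y hy => h3 x y (hmem x hx) (hmem y hy))

end Order

/-! ### The signed count of inversions -/

section SignedCount

variable {cs} {lt : cs.reflections → cs.reflections → Prop} {A : Set W}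

/-- On {t, u, u'} the set N(w) is closed downwards or upwards, A is closed downwards, and t ∉ N(w).
If t is between u and u', then N(w) misses one of them. If both are on one side of t, then N(w) can
only be closed in the direction away from t, unless it contains neither. -/
theorem IsReflectionOrder.section_conditions (h : cs.IsReflectionOrder lt)
    (hA : ∀ a b : cs.reflections, (a : W) ∈ A → (b : W) ∉ A → lt a b)
    {t u u' : cs.reflections} (hut : u ≠ t) (hu' : (u' : W) = t * u * t) {w : W}
    (htw : (t : W) ∉ cs.inversionSet w) :
    ((u : W) ∈ cs.inversionSet t → ¬((u : W) ∈ cs.inversionSet w ∧ (u' : W) ∈ cs.inversionSet w) ∧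
      ((t : W) ∈ A → (u : W) ∈ A ∨ (u' : W) ∈ A) ∧
      ((t : W) ∉ A → ¬((u : W) ∈ A ∧ (u' : W) ∈ A))) ∧
    ((u : W) ∉ cs.inversionSet t → (u : W) ∉ A → (u' : W) ∈ A →
      ((t : W) ∈ A → (u' : W) ∈ cs.inversionSet w → (u : W) ∈ cs.inversionSet w) ∧
      ((t : W) ∉ A → (u : W) ∈ cs.inversionSet w → (u' : W) ∈ cs.inversionSet w)) := by
  have hlt := h.strictTotalOrder
  have hasymm : ∀ x y, lt x y → ¬lt y x := fun x y => asymm_of lt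
  obtain ⟨h1, h2, h3⟩ := h.position hut hu'
  constructor
  · intro hN
    have h4 := h1 hN
    refine ⟨?_, fun htA => ?_, fun htA ⟨huA, huA'⟩ => ?_⟩
    rotate_left
    · by_contra! hc
      rcases h4 with h4 | h4
      · exact hasymm _ _ h4.1 (hA t u htA hc.1)
      · exact hasymm _ _ h4.1 (hA t u' htA hc.2)
    · rcases h4 with h4 | h4
      · exact hasymm _ _ h4.2 (hA u' t huA' htA)
      · exact hasymm _ _ h4.2 (hA u t huA htA)
    rintro ⟨hu, hu''⟩
    rcases h3 w with h5 | h5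
    · rcases h4 with h4 | h4
      · exact htw (h5 t (by simp) u' (by simp) h4.2 hu'')
      · exact htw (h5 t (by simp) u (by simp) h4.2 hu)
    · rcases h4 with h4 | h4
      · exact htw (h5 u (by simp) t (by simp) h4.1 hu)
      · exact htw (h5 u' (by simp) t (by simp) h4.1 hu'')
  · intro hN huA hu'A
    have huu := hA u' u hu'A huA
    constructor
    · intro htA hu''
      have htu := hA t u htA huA
      have htu' : lt t u' := by
        rcases h2 hN with h4 | h4
        · exact h4.2
        · exact absurd h4.1 (hasymm _ _ htu)
      rcases h3 w with h5 | h5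
      · exact absurd (h5 t (by simp) u' (by simp) htu' hu'') htw
      · exact h5 u' (by simp) u (by simp) huu hu''
    · intro htA hu
      have htu' := hA u' t hu'A htA
      have htu : lt u t := by
        rcases h2 hN with h4 | h4
        · exact absurd h4.2 (hasymm _ _ htu')
        · exact h4.1
      rcases h3 w with h5 | h5
      · exact h5 u' (by simp) u (by simp) huu hu
      · exact absurd (h5 u (by simp) t (by simp) htu hu) htw

open scoped Classical in
/-- The number of inversions of `w` outside `A` minus the number of those in `A`. -/
noncomputable def signedCount (cs : CoxeterSystem M W) (A : Set W) (w : W) : ℤ :=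
  ∑ v ∈ (cs.finite_inversionSet w).toFinset, if v ∈ A then -1 else 1

open scoped Classical in
/-- The contribution of `v` to the difference of the signed counts of `y` and `w`. -/
noncomputable def signedDiff (cs : CoxeterSystem M W) (A : Set W) (y w v : W) : ℤ :=
  ((if v ∈ cs.inversionSet y then 1 else 0) - (if v ∈ cs.inversionSet w then 1 else 0)) *
    (if v ∈ A then -1 else 1)

theorem signedCount_sub_eq_sum (y w : W) (F : Finset W)
    (hy : cs.inversionSet y ⊆ F) (hw : cs.inversionSet w ⊆ F) :
    signedCount cs A y - signedCount cs A w = ∑ v ∈ F, signedDiff cs A y w v := by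
  classical
  have key : ∀ z, cs.inversionSet z ⊆ F → signedCount cs A z =
      ∑ v ∈ F, (if v ∈ cs.inversionSet z then 1 else 0) * (if v ∈ A then -1 else 1) := by
    intro z hz
    simp only [ite_mul, one_mul, zero_mul]
    rw [← Finset.sum_filter, signedCount]
    refine Finset.sum_congr ?_ fun _ _ => rfl
    ext v
    simp only [Set.Finite.mem_toFinset, Finset.mem_filter]
    exact ⟨fun h => ⟨hz h, h⟩, fun h => h.2⟩
  rw [key y hy, key w hw, ← Finset.sum_sub_distrib]
  exact Finset.sum_congr rfl fun v _ => (sub_mul _ _ _).symm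

/-- Let u' = tut, let ε be -1 on A and 1 off A, and let [v] indicate v ∈ N(w). The sum is (1 - [u] -
[u'])(ε(u) + ε(u')) if u ∈ N(t), and ([u'] - [u])(ε(u) - ε(u')) otherwise; `section_conditions`
controls the signs of the factors. -/
theorem IsReflectionOrder.signedDiff_add_signedDiff_conj (h : cs.IsReflectionOrder lt)
    (hA : ∀ a b : cs.reflections, (a : W) ∈ A → (b : W) ∉ A → lt a b)
    {t u w : W} (ht : cs.IsReflection t) (hu : cs.IsReflection u) (hut : u ≠ t)
    (htw : t ∉ cs.inversionSet w) :
    (t ∈ A → signedDiff cs A (t * w) w u + signedDiff cs A (t * w) w (t * u * t) ≤ 0) ∧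
    (t ∉ A → 0 ≤ signedDiff cs A (t * w) w u + signedDiff cs A (t * w) w (t * u * t)) := by
  have hu' := hu.conj_mul ht
  have hut' : t * u * t ≠ t := by
    intro h1
    apply hut
    rw [← ht.conj_conj u, h1, ht.mul_self, one_mul]
  obtain ⟨h1, h2⟩ := h.section_conditions hA (t := ⟨t, ht⟩) (u := ⟨u, hu⟩)
    (u' := ⟨t * u * t, hu'⟩) (fun h => hut (congrArg Subtype.val h)) rfl htw
  -- Exchanging u and tut covers the case u ∈ A, tut ∉ A.
  obtain ⟨-, h4⟩ := h.section_conditions hA (t := ⟨t, ht⟩) (u := ⟨t * u * t, hu'⟩)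
    (u' := ⟨u, hu⟩) (fun h => hut' (congrArg Subtype.val h)) (ht.conj_conj u).symm htw
  have h5 := hu.mem_inversionSet_mul t w
  have h6 := hu'.mem_inversionSet_mul t w
  have h7 := ht.mem_inversionSet_conj hu
  rw [ht.inv] at h5 h6
  rw [ht.conj_conj, h7] at h6
  rw [h7] at h4
  simp only [signedDiff]
  dsimp only at h1 h2 h4
  clear h7 h hA
  generalize (u ∈ cs.inversionSet (t * w)) = Q at *
  generalize (t * u * t ∈ cs.inversionSet (t * w)) = Q' at *
  generalize (t * u * t ∈ cs.inversionSet w) = P' at *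
  generalize (u ∈ cs.inversionSet w) = P at *
  generalize (u ∈ cs.inversionSet t) = n at *
  generalize (t * u * t ∈ A) = a' at *
  generalize (u ∈ A) = a at *
  generalize (t ∈ A) = b at *
  obtain rfl := propext h5
  obtain rfl := propext h6
  clear h5 h6
  constructor
  · intro hb
    by_cases hn : n <;> by_cases hP : P <;> by_cases hP' : P' <;> by_cases ha : a <;>
      by_cases ha' : a' <;> simp [hn, hP, hP', ha, ha', hb] at h1 h2 h4 ⊢
  · intro hb
    by_cases hn : n <;> by_cases hP : P <;> by_cases hP' : P' <;> by_cases ha : a <;>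
      by_cases ha' : a' <;> simp [hn, hP, hP', ha, ha', hb] at h1 h2 h4 ⊢

theorem IsReflectionOrder.signedCount_mul (h : cs.IsReflectionOrder lt)
    (hA : ∀ a b : cs.reflections, (a : W) ∈ A → (b : W) ∉ A → lt a b)
    {t w : W} (ht : cs.IsReflection t) (htw : t ∉ cs.inversionSet w) :
    (t ∈ A → signedCount cs A (t * w) < signedCount cs A w) ∧
    (t ∉ A → signedCount cs A w < signedCount cs A (t * w)) := by
  classical
  have hfin : (cs.inversionSet t ∪ cs.inversionSet w ∪
      (fun v => t * v * t) '' cs.inversionSet w).Finite :=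
    ((cs.finite_inversionSet t).union (cs.finite_inversionSet w)).union
      ((cs.finite_inversionSet w).image _)
  -- A finite set of reflections, stable under conjugation by t, that contains t, N(w) and N(tw).
  set F := hfin.toFinset with hF
  have hmem : ∀ v, v ∈ F ↔ v ∈ cs.inversionSet t ∨ v ∈ cs.inversionSet w ∨
      ∃ x ∈ cs.inversionSet w, t * x * t = v := by
    intro v
    simp [hF, or_assoc]
  have hrefl : ∀ v ∈ F, cs.IsReflection v := by
    intro v hv
    rcases (hmem v).1 hv with hv | hv | ⟨x, hx, rfl⟩
    · exact hv.1
    · exact hv.1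
    · exact hx.1.conj_mul ht
  have hconj : ∀ v ∈ F, t * v * t ∈ F := by
    intro v hv
    rw [hmem]
    rcases (hmem v).1 hv with hv | hv | ⟨x, hx, rfl⟩
    · exact Or.inl ((ht.mem_inversionSet_conj hv.1).2 hv)
    · exact Or.inr (Or.inr ⟨v, hv, rfl⟩)
    · exact Or.inr (Or.inl (by rwa [ht.conj_conj]))
  have htF : t ∈ F := (hmem t).2 (Or.inl ht.mem_inversionSet_self)
  have hwF : cs.inversionSet w ⊆ F := fun v hv => (hmem v).2 (Or.inr (Or.inl hv))
  have hyF : cs.inversionSet (t * w) ⊆ F := by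
    intro v hv
    have h1 := (hv.1.mem_inversionSet_mul t w).1 hv
    rw [ht.inv] at h1
    by_cases h2 : v ∈ cs.inversionSet t
    · exact (hmem v).2 (Or.inl h2)
    · exact (hmem v).2 (Or.inr (Or.inr ⟨t * v * t, by tauto, ht.conj_conj v⟩))
  have hsum := signedCount_sub_eq_sum (A := A) (t * w) w F hyF hwF
  rw [← Finset.add_sum_erase F _ htF] at hsum
  -- Summing the pair estimate over all v ≠ t counts the remaining sum twice, so reflections
  -- commuting with t need no separate treatment.
  have hinvol : ∑ v ∈ F.erase t, signedDiff cs A (t * w) w (t * v * t) =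
      ∑ v ∈ F.erase t, signedDiff cs A (t * w) w v := by
    have hmaps : ∀ v ∈ F.erase t, t * v * t ∈ F.erase t := by
      intro v hv
      obtain ⟨hvt, hvF⟩ := Finset.mem_erase.1 hv
      refine Finset.mem_erase.2 ⟨fun h1 => hvt ?_, hconj v hvF⟩
      rw [← ht.conj_conj v, h1, ht.mul_self, one_mul]
    exact Finset.sum_nbij' (fun v => t * v * t) (fun v => t * v * t) hmaps hmaps
      (fun v _ => ht.conj_conj v) (fun v _ => ht.conj_conj v) fun v _ => rfl
  have hpair : ∀ v ∈ F.erase t, _ := fun v hv =>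
    h.signedDiff_add_signedDiff_conj hA ht (hrefl v (Finset.mem_erase.1 hv).2)
      (Finset.mem_erase.1 hv).1 htw
  have hty : t ∈ cs.inversionSet (t * w) := by
    have h1 := ht.mem_inversionSet_mul t w
    rw [ht.inv, ht.mul_self, one_mul] at h1
    have := ht.mem_inversionSet_self
    tauto
  constructor
  · intro htA
    have h1 := Finset.sum_nonpos fun v hv => (hpair v hv).1 htA
    rw [Finset.sum_add_distrib, hinvol] at h1
    have h2 : signedDiff cs A (t * w) w t = -1 := by simp [signedDiff, htA, htw, hty]
    omega
  · intro htA
    have h1 := Finset.sum_nonneg fun v hv => (hpair v hv).2 htA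
    rw [Finset.sum_add_distrib, hinvol] at h1
    have h2 : signedDiff cs A (t * w) w t = 1 := by simp [signedDiff, htA, htw, hty]
    omega

end SignedCount

/-! ### The preclosures -/

theorem signedCount_one (A : Set W) : signedCount cs A 1 = 0 := by
  refine Finset.sum_eq_zero fun v hv => ?_
  exact absurd ((Set.Finite.mem_toFinset _).1 hv) (cs.not_mem_inversionSet_one v)

variable {cs} in
theorem IsReflection.ne_one {t : W} (ht : cs.IsReflection t) : t ≠ 1 := by
  rintro rfl
  simpa using ht.odd_length

variable {cs} in
theorem BruhatEdge.not_mem_inversionSet {x t y : W} (h : cs.BruhatEdge x t y) :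
    t ∉ cs.inversionSet x⁻¹ := by
  intro h1
  have h2 := h1.2
  rw [← cs.length_inv, mul_inv_rev, inv_inv, h.1.inv, cs.length_inv, ← h.2.1] at h2
  exact lt_asymm h2 h.2.2

variable {cs} in
theorem IsReflection.mem_bruhatPreclosure {A : Set W} {t : W} (ht : cs.IsReflection t)
    (htA : t ∈ A) : t ∈ cs.bruhatPreclosure A := by
  refine ⟨ht, Relation.ReflTransGen.single ⟨t, htA, ht, (one_mul t).symm, ?_⟩⟩
  rw [cs.length_one]
  exact Nat.pos_of_ne_zero fun h => ht.ne_one (cs.length_eq_zero_iff.1 h)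

variable {cs} in
-- Inverses turn the right multiplications of the path into left ones, and an edge x → xt means t ∉
-- N(x⁻¹), so each step lowers the count.
theorem ExistsPath.signedCount_neg {lt : cs.reflections → cs.reflections → Prop} {A : Set W}
    (h : cs.IsReflectionOrder lt)
    (hA : ∀ a b : cs.reflections, (a : W) ∈ A → (b : W) ∉ A → lt a b) {x : W}
    (hx : cs.ExistsPath A 1 x) : x = 1 ∨ signedCount cs A x⁻¹ < 0 := by
  induction hx with
  | refl => exact Or.inl rfl
  | tail _ hstep ih =>
    rename_i y z _
    obtain ⟨t, htA, ht⟩ := hstep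
    right
    have h1 := (h.signedCount_mul hA ht.1 ht.not_mem_inversionSet).1 htA
    have h2 : z⁻¹ = t * y⁻¹ := by rw [ht.2.1, mul_inv_rev, ht.1.inv]
    rw [h2]
    rcases ih with rfl | ih
    · rwa [inv_one, signedCount_one, ← inv_one] at h1
    · exact h1.trans ih

variable {cs} in
theorem IsInitialSection.mem_of_mem_bruhatPreclosure {A : Set W} (hA : cs.IsInitialSection A)
    {t : W} (ht : t ∈ cs.bruhatPreclosure A) : t ∈ A := by
  obtain ⟨-, lt, h, hlt⟩ := hA
  by_contra htA
  have h1 := (ht.2.signedCount_neg h hlt).resolve_left ht.1.ne_one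
  have h2 := (h.signedCount_mul hlt ht.1 (cs.not_mem_inversionSet_one t)).2 htA
  rw [ht.1.inv] at h1
  rw [mul_one, signedCount_one] at h2
  exact lt_asymm h1 h2

variable {cs} in
-- The reflection xtx⁻¹ carries xw to yw. It is not in N(x) because the edge goes up, so t ∈ N(w)
-- puts it in N(xw).
theorem BruhatEdge.length_mul_lt {x t y w : W} (h : cs.BruhatEdge x t y)
    (ht : t ∈ cs.inversionSet w) : cs.length (y * w) < cs.length (x * w) := by
  have h1 := (h.1.conj x).mem_inversionSet_mul x w
  have h2 := h.1.mem_inversionSet_inv x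
  have h3 := h.not_mem_inversionSet
  have e : x⁻¹ * (x * t * x⁻¹) * x = t := by group
  rw [e] at h1
  have h4 : x * t * x⁻¹ ∈ cs.inversionSet (x * w) := by tauto
  have h5 := h4.2
  rwa [show x * t * x⁻¹ * (x * w) = y * w by rw [h.2.1]; group] at h5

variable {cs} in
theorem ExistsPath.length_mul_lt {w x : W} (hx : cs.ExistsPath (cs.inversionSet w) 1 x) :
    x = 1 ∨ cs.length (x * w) < cs.length w := by
  induction hx with
  | refl => exact Or.inl rfl
  | tail _ hstep ih =>
    obtain ⟨t, htA, ht⟩ := hstep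
    right
    have h1 := ht.length_mul_lt htA
    rcases ih with rfl | ih
    · rwa [one_mul] at h1
    · exact h1.trans ih

end CoxeterSystem

theorem mainTheorem2 {B : Type*} {W : Type*} [Group W] {M : CoxeterMatrix B}
    (cs : CoxeterSystem M W) :
    (∀ A : Set W, cs.IsInitialSection A →
      ∀ t : W, cs.IsReflection t → (t ∈ cs.bruhatPreclosure A ↔ t ∈ A)) ∧
    (∀ w t : W, cs.IsReflection t →
      (t ∈ cs.bruhatPreclosure (cs.inversionSet w) ↔ t ∈ cs.inversionSet w)) :=
  ⟨fun _ hA _ ht => ⟨hA.mem_of_mem_bruhatPreclosure, ht.mem_bruhatPreclosure⟩,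
    fun _ _ ht => ⟨fun h => ⟨ht, h.2.length_mul_lt.resolve_left ht.ne_one⟩,
      ht.mem_bruhatPreclosure⟩⟩
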